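/- All graphs are finite and simple. For a graph $G$, let $\gamma(G)$ be its domination number, i.e. the least size of a set $D\subseteq V(G)$ such that every vertex outside $D$ is adjacent to a vertex of $D$; a *minimum dominating set* is such a set of size $\gamma(G)$. For $k\ge 1$, the *eternal distance-$k$ domination number* $\gamma^\infty_{all,k}(G)$ is the least $n$ for which there is a nonempty collection of configurations of $n$ guards on the vertices of $G$ (several guards may occupy the same vertex) such that in every configuration of the collection each vertex is within distance $k$ of some guard and, from every configuration of the collection and for every attacked vertex $v$, the guards can all move simultaneously, each by a distance of at most $k$, to a configuration of the collection in which $v$ is occupied. Let $\mathcal T$ be the smallest family of trees, closed under isomorphism, such that: 1. every tree of diameter at most $3$ is in $\mathcal T$; 2. if $T\in\mathcal T$, then every tree formed by appending to $T$ a star $K_{1,m}$ with $m\ge 2$, adding an edge between a leaf of $K_{1,m}$ and any vertex of $T$, is in $\mathcal T$; 3. if $T\in\mathcal T$ and $v$ is a leaf of $T$ that belongs to some minimum dominating set of $T$, then every tree formed by appending to $v$ a star $K_{1,m}$ with $m\ge 1$, adding an edge between $v$ and the centre of the star, and also appending $t\ge 1$ leaves to $v$, is in $\mathcal T$; 4.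 if $T\in\mathcal T$ and $v$ is a leaf of $T$ with $\gamma(T-v)=\gamma(T)-1$, then every tree formed by appending to $v$ two stars $K_{1,m}$ and $K_{1,M}$ with $m,M\ge 1$, adding an edge between $v$ and the centre of each star, is in $\mathcal T$. (A leaf of a tree is a vertex of degree $1$; for $K_{1,1}$ either vertex may be taken as the centre.) **Theorem.** If $T$ is a tree, then $\gamma^\infty_{all,2}(T)=\gamma(T)$ if and only if $T\in\mathcal T$. -/

import Mathlib

namespace EternalDomination

open SimpleGraph

universe u

/-- `D` is a dominating set of `G`: every vertex outside `D` is adjacent to a vertex of `D`. -/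
def IsDominating {V : Type u} (G : SimpleGraph V) (D : Finset V) : Prop :=
  ∀ v, v ∉ D → ∃ w ∈ D, G.Adj w v

/-- The domination number `γ(G)` of a finite graph: the least size of a dominating set. -/
noncomputable def dominationNumber {V : Type u} (G : SimpleGraph V) : ℕ :=
  sInf {n | ∃ D : Finset V, IsDominating G D ∧ D.card = n}

/-- `D` is a minimum dominating set of `G`. -/
def IsMinDominating {V : Type u} (G : SimpleGraph V) (D : Finset V) : Prop :=
  IsDominating G D ∧ D.card = dominationNumber G

/-- A configuration of `n` guards, where `c i` is the vertex occupied by guard `i` (several guards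
may share a vertex), is distance-`k` dominating: every vertex is within distance `k` of a guard. -/
def IsDistDominating {V : Type u} (G : SimpleGraph V) (k : ℕ) {n : ℕ} (c : Fin n → V) : Prop :=
  ∀ v, ∃ i, G.edist (c i) v ≤ k

/-- A collection `F` of configurations of `n` guards eternally distance-`k` dominates `G`: all its
members are distance-`k` dominating and, whatever the current configuration `c` of `F` and whatever
the attacked vertex `v`, all guards can move simultaneously, each by a distance of at most `k`, to a
configuration of `F` in which some guard occupies `v`. -/
def IsEternalFamily {V : Type u} (G : SimpleGraph V) (k : ℕ) {n : ℕ} (F : Set (Fin n → V)) :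
    Prop :=
  F.Nonempty ∧ (∀ c ∈ F, IsDistDominating G k c) ∧
    ∀ c ∈ F, ∀ v, ∃ c' ∈ F, (∀ i, G.edist (c i) (c' i) ≤ k) ∧ ∃ i, c' i = v

/-- The eternal distance-`k` domination number `γ_{all,k}^∞(G)` of a finite graph: the least number
of guards that can answer every infinite sequence of attacks. -/
noncomputable def eternalDominationNumber {V : Type u} (G : SimpleGraph V) (k : ℕ) : ℕ :=
  sInf {n | ∃ F : Set (Fin n → V), IsEternalFamily G k F}

/-- A leaf: a vertex with exactly one neighbour. -/
def IsLeaf {V : Type u} (G : SimpleGraph V) (v : V) : Prop :=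
  ∃! w, G.Adj v w

/-- The disjoint union of `G` and `H` together with the edges joining the vertex `v` of `G` to the
vertices of `H` that lie in `B`. -/
def attach {V W : Type*} (G : SimpleGraph V) (v : V) (H : SimpleGraph W) (B : Set W) :
    SimpleGraph (V ⊕ W) :=
  (G ⊕g H) ⊔ SimpleGraph.fromRel fun x y => x = Sum.inl v ∧ ∃ b ∈ B, y = Sum.inr b

/-- The star `K_{1,m}`; its centre is `0` and its `m` other vertices are `1, …, m`. -/
abbrev starK (m : ℕ) : SimpleGraph (Fin (m + 1)) := starGraph 0

/-- The recursively defined family `𝒯` of trees (closed under isomorphism). -/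
inductive TreeFamily : ∀ {V : Type u}, SimpleGraph V → Prop
  /-- Every (finite) tree of diameter at most 3 belongs to the family. -/
  | small {V : Type u} [Finite V] (G : SimpleGraph V) (hG : G.IsTree) (hd : G.diam ≤ 3) :
      TreeFamily G
  /-- Append a star `K_{1,m}`, `m ≥ 2`, by an edge from a leaf of the star to any vertex. -/
  | appendStar {V : Type u} (G : SimpleGraph V) (hG : TreeFamily G) (x : V) (m : ℕ) (hm : 2 ≤ m) :
      TreeFamily (attach G x (starK m) {Fin.last m})
  /-- At a leaf `v` that lies in some minimum dominating set, append a star `K_{1,m}`, `m ≥ 1`, by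
  an edge from `v` to its centre, as well as `t ≥ 1` leaves. -/
  | appendStarLeaves {V : Type u} (G : SimpleGraph V) (hG : TreeFamily G) (v : V)
      (hv : IsLeaf G v) (hD : ∃ D, IsMinDominating G D ∧ v ∈ D)
      (m t : ℕ) (hm : 1 ≤ m) (ht : 1 ≤ t) :
      TreeFamily (attach (attach G v (starK m) {0}) (Sum.inl v)
        (⊥ : SimpleGraph (Fin t)) Set.univ)
  /-- At a leaf `v` with `γ(G - v) = γ(G) - 1`, append two stars `K_{1,m}` and `K_{1,M}` with
  `m, M ≥ 1` by edges from `v` to their centres. -/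
  | appendTwoStars {V : Type u} (G : SimpleGraph V) (hG : TreeFamily G) (v : V)
      (hv : IsLeaf G v) (hγ : dominationNumber (G.induce {v}ᶜ) + 1 = dominationNumber G)
      (m M : ℕ) (hm : 1 ≤ m) (hM : 1 ≤ M) :
      TreeFamily (attach (attach G v (starK m) {0}) (Sum.inl v) (starK M) {0})
  /-- The family is closed under isomorphism. -/
  | iso {V W : Type u} (G : SimpleGraph V) (H : SimpleGraph W) (hG : TreeFamily G)
      (e : G ≃g H) : TreeFamily H

end EternalDomination

namespace EternalDomination

open SimpleGraph

universe u

/-! A guard confined to the closed neighbourhood of a vertex can always reach any point of it in one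
move, so a minimum dominating set yields `γ^∞ ≤ γ`. Only `γ ≤ γ^∞` has to be characterised.

Members of the family: each operation raises `γ` by at most one and `γ^∞` by at least one. The
second fact is `Answers.drop_guard`. An appended star has a leaf `ℓ` that can be defended only from
a small set `S`, so every configuration has a guard in `S`. Contract the new part and ignore one
such guard. The others defend the old tree, and when the ignored guard changes, the two exchange
roles, since everything near `S` contracts to pairwise near vertices.

Converse, by induction on the number of vertices: in a tree of diameter at least 4, let `q` be the
grandparent of a deepest vertex; all grandchildren of `q` are leaves. Cutting off the end of the
tree at `q` lowers `γ^∞` by at most one, because one extra guard suffices for the removed part (the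
two lemmas `eternalDominationNumber_le_succ_of_*`), and lowers `γ` by at least one. Hence `γ ≤ γ^∞`
passes to the smaller tree. The number of children of `q`, and of those with children, decides which
operation is undone. The side conditions of operations 3 and 4 hold because the inequalities `γ(T) ≤
γ^∞(T) ≤ γ^∞(T₀) + 1 ≤ γ(T₀) + 1` leave a minimum dominating set of `T` no slack. -/

/-! ### Distance at most two -/

/-- `a` lies in the closed neighbourhood of `b`. -/
def CloseAdj {V : Type*} (G : SimpleGraph V) (a b : V) : Prop :=
  a = b ∨ G.Adj a b

/-- `a` and `b` lie in a common closed neighbourhood, i.e. their distance is at most two. -/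
def Near {V : Type*} (G : SimpleGraph V) (a b : V) : Prop :=
  ∃ w, CloseAdj G a w ∧ CloseAdj G w b

section Near

variable {V W : Type*} {G : SimpleGraph V} {H : SimpleGraph W}

lemma CloseAdj.refl (a : V) : CloseAdj G a a := Or.inl rfl

lemma CloseAdj.symm {a b : V} (h : CloseAdj G a b) : CloseAdj G b a :=
  h.imp Eq.symm Adj.symm

lemma Near.refl (a : V) : Near G a a := ⟨a, .refl a, .refl a⟩

lemma Near.symm {a b : V} (h : Near G a b) : Near G b a :=
  let ⟨w, h₁, h₂⟩ := h
  ⟨w, h₂.symm, h₁.symm⟩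

lemma CloseAdj.near {a b : V} (h : CloseAdj G a b) : Near G a b := ⟨b, h, .refl b⟩

lemma edist_le_two_iff_near {a b : V} : G.edist a b ≤ ((2 : ℕ) : ℕ∞) ↔ Near G a b := by
  constructor
  · intro h
    obtain ⟨p, hp⟩ := exists_walk_of_edist_ne_top (ne_top_of_le_ne_top (ENat.natCast_ne_top 2) h)
    rw [← hp, Nat.cast_le] at h
    match p, h with
    | .nil, _ => exact .refl _
    | .cons h₁ .nil, _ => exact CloseAdj.near (Or.inr h₁)
    | .cons h₁ (.cons h₂ .nil), _ => exact ⟨_, Or.inr h₁, Or.inr h₂⟩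
    | .cons h₁ (.cons h₂ (.cons h₃ p)), h => simp at h
  · rintro ⟨w, h₁, h₂⟩
    have key : ∀ {x y : V}, CloseAdj G x y → G.edist x y ≤ 1 := fun h =>
      edist_le_one_iff_adj_or_eq.2 (Or.symm h)
    calc G.edist a b ≤ G.edist a w + G.edist w b := G.edist_triangle
      _ ≤ 1 + 1 := add_le_add (key h₁) (key h₂)
      _ = ((2 : ℕ) : ℕ∞) := by norm_num

lemma Near.map {f : V → W} (hf : ∀ a b, CloseAdj G a b → CloseAdj H (f a) (f b)) {a b : V}
    (h : Near G a b) : Near H (f a) (f b) :=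
  let ⟨w, h₁, h₂⟩ := h
  ⟨f w, hf _ _ h₁, hf _ _ h₂⟩

lemma CloseAdj.map_embedding (f : G ↪g H) {a b : V} (h : CloseAdj G a b) :
    CloseAdj H (f a) (f b) :=
  h.imp (congrArg f) f.map_rel_iff.2

/-- The vertices within distance two of a leaf are the closed neighbourhood of its neighbour. -/
lemma IsLeaf.near_of_near {V : Type u} {G : SimpleGraph V} {v a b : V} (hv : IsLeaf G v)
    (ha : Near G a v) (hb : Near G b v) : Near G a b := by
  obtain ⟨w, hw, huniq⟩ := hv
  have key : ∀ c, Near G c v → CloseAdj G c w := by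
    rintro c ⟨x, h₁, h₂⟩
    rcases h₂ with rfl | h₂
    · rcases h₁ with rfl | h₁
      · exact Or.inr hw
      · exact Or.inl (huniq _ h₁.symm)
    · exact huniq _ h₂.symm ▸ h₁
  exact ⟨w, key a ha, (key b hb).symm⟩

end Near

/-! ### Dominating sets -/

section Domination

variable {V : Type u} {G : SimpleGraph V}

lemma dominationNumber_le {D : Finset V} (hD : IsDominating G D) :
    dominationNumber G ≤ D.card :=
  Nat.sInf_le ⟨D, hD, rfl⟩

lemma exists_isMinDominating [Finite V] (G : SimpleGraph V) : ∃ D, IsMinDominating G D := by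
  have := Fintype.ofFinite V
  obtain ⟨D, hD, hc⟩ := Nat.sInf_mem (s := {n | ∃ D : Finset V, IsDominating G D ∧ D.card = n})
    ⟨_, Finset.univ, fun v hv => absurd (Finset.mem_univ v) hv, rfl⟩
  exact ⟨D, hD, hc⟩

lemma isDominating_iff {D : Finset V} :
    IsDominating G D ↔ ∀ v, ∃ w ∈ D, CloseAdj G w v := by
  constructor
  · intro h v
    by_cases hv : v ∈ D
    · exact ⟨v, hv, .refl v⟩
    · obtain ⟨w, hw, hwv⟩ := h v hv
      exact ⟨w, hw, Or.inr hwv⟩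
  · intro h v hv
    obtain ⟨w, hw, rfl | hwv⟩ := h v
    · exact absurd hw hv
    · exact ⟨w, hw, hwv⟩

/-- Deleting a vertex lowers the domination number by at most one. -/
lemma dominationNumber_le_induce_compl_singleton [Finite V] (G : SimpleGraph V) (v : V) :
    dominationNumber G ≤ dominationNumber (G.induce {v}ᶜ) + 1 := by
  classical
  obtain ⟨D, hD, hc⟩ := exists_isMinDominating (G.induce {v}ᶜ)
  rw [← hc]
  refine (dominationNumber_le (D := insert v (D.map (Function.Embedding.subtype _))) ?_).trans
    ((Finset.card_insert_le _ _).trans (by simp))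
  rw [isDominating_iff] at hD ⊢
  intro x
  by_cases hx : x = v
  · exact ⟨v, by simp, Or.inl hx.symm⟩
  · obtain ⟨w, hw, hwx⟩ := hD ⟨x, hx⟩
    exact ⟨w, by simpa [hw] using em _, hwx.imp (congrArg Subtype.val) id⟩

end Domination

/-! ### Eternal families -/

/-- `F` can answer every attack with moves of length at most two. -/
def Answers {V : Type*} (G : SimpleGraph V) {n : ℕ} (F : Set (Fin n → V)) : Prop :=
  ∀ c ∈ F, ∀ v, ∃ c' ∈ F, (∀ i, Near G (c i) (c' i)) ∧ ∃ i, c' i = v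

section Eternal

variable {V : Type u} {G : SimpleGraph V}

/-- The domination requirement is redundant: the guard that would answer an attack at `v` is already
within distance two of `v`. -/
lemma isEternalFamily_two_iff {n : ℕ} {F : Set (Fin n → V)} :
    IsEternalFamily G 2 F ↔ F.Nonempty ∧ Answers G F := by
  simp only [IsEternalFamily, IsDistDominating, Answers, edist_le_two_iff_near]
  refine ⟨fun h => ⟨h.1, h.2.2⟩, fun h => ⟨h.1, fun c hc v => ?_, h.2⟩⟩
  obtain ⟨c', -, hmove, i, rfl⟩ := h.2 c hc v
  exact ⟨i, hmove i⟩

lemma eternalDominationNumber_le {n : ℕ} {F : Set (Fin n → V)} (hne : F.Nonempty)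
    (hF : Answers G F) : eternalDominationNumber G 2 ≤ n :=
  Nat.sInf_le ⟨F, isEternalFamily_two_iff.2 ⟨hne, hF⟩⟩

/-- One guard on each star of a partition into stars answers all attacks. -/
lemma exists_answers_of_isDominating {D : Finset V} (hD : IsDominating G D) :
    ∃ F : Set (Fin D.card → V), F.Nonempty ∧ Answers G F := by
  rw [isDominating_iff] at hD
  let e := D.equivFin
  refine ⟨{c | ∀ i, CloseAdj G (e.symm i : V) (c i)}, ⟨fun i => e.symm i, fun i => .refl _⟩, ?_⟩
  intro c hc v
  obtain ⟨w, hw, hwv⟩ := hD v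
  refine ⟨Function.update c (e ⟨w, hw⟩) v, fun i => ?_, fun i => ?_, e ⟨w, hw⟩, by simp⟩
  · by_cases hi : i = e ⟨w, hw⟩
    · subst hi
      simpa using hwv
    · simpa [hi] using hc i
  · by_cases hi : i = e ⟨w, hw⟩
    · subst hi
      have := hc (e ⟨w, hw⟩)
      simp only [Equiv.symm_apply_apply] at this
      simpa using ⟨w, this.symm, hwv⟩
    · simpa [hi] using Near.refl _

variable [Finite V]

lemma eternalDominationNumber_le_dominationNumber (G : SimpleGraph V) :
    eternalDominationNumber G 2 ≤ dominationNumber G := by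
  obtain ⟨D, hD, hc⟩ := exists_isMinDominating G
  obtain ⟨F, hne, hF⟩ := exists_answers_of_isDominating hD
  exact hc ▸ eternalDominationNumber_le hne hF

lemma exists_answers (G : SimpleGraph V) :
    ∃ F : Set (Fin (eternalDominationNumber G 2) → V), F.Nonempty ∧ Answers G F := by
  obtain ⟨D, hD, -⟩ := exists_isMinDominating G
  obtain ⟨F, h⟩ := exists_answers_of_isDominating hD
  obtain ⟨F', h'⟩ := Nat.sInf_mem (s := {n | ∃ F : Set (Fin n → V), IsEternalFamily G 2 F})
    ⟨_, F, isEternalFamily_two_iff.2 h⟩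
  exact ⟨F', isEternalFamily_two_iff.1 h'⟩

end Eternal

/-! ### Guard numbers of a graph and of an extension of it -/

section Compare

variable {V V' : Type u} {G : SimpleGraph V} {G' : SimpleGraph V'}

/-- If some guard always stays in `S`, then one guard can be dropped after a retraction `r` that
contracts the vertices near `S` to a set of diameter at most two. -/
lemma Answers.drop_guard {n : ℕ} {F : Set (Fin (n + 1) → V')} (hne : F.Nonempty)
    (hF : Answers G' F) (r : V' → V) (S : Set V') (ℓ : V')
    (hr : ∀ a b, Near G' a b → Near G (r a) (r b)) (hℓ : ∀ a, Near G' a ℓ → a ∈ S)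
    (hu : ∀ u, ∃ u' ∉ S, r u' = u)
    (hS : ∀ s ∈ S, ∀ s' ∈ S, ∀ a b, Near G' a s → Near G' b s' → Near G (r a) (r b)) :
    ∃ F₀ : Set (Fin n → V), F₀.Nonempty ∧ Answers G F₀ := by
  have hmem : ∀ c ∈ F, ∃ i, c i ∈ S := fun c hc => by
    obtain ⟨c', -, hmove, i, rfl⟩ := hF c hc ℓ
    exact ⟨i, hℓ _ (hmove i)⟩
  -- The permutation `σ` does the bookkeeping: guard `σ 0` stands in `S` and is ignored, guard `σ
  -- j.succ` plays the role of `j`.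
  refine ⟨{c₀ | ∃ c ∈ F, ∃ σ : Equiv.Perm (Fin (n + 1)), c (σ 0) ∈ S ∧
    ∀ j : Fin n, c₀ j = r (c (σ j.succ))}, ?_, ?_⟩
  · obtain ⟨c, hc⟩ := hne
    obtain ⟨i, hi⟩ := hmem c hc
    exact ⟨_, c, hc, Equiv.swap 0 i, by simpa using hi, fun j => rfl⟩
  · rintro c₀ ⟨c, hc, σ, hσ, hc₀⟩ u
    obtain ⟨u', hu', rfl⟩ := hu u
    obtain ⟨c', hc', hmove, k, rfl⟩ := hF c hc u'
    obtain ⟨A, hA⟩ := hmem c' hc'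
    -- After the move a guard `A` in `S` is ignored; the previously ignored guard takes over the
    -- role that `A` had.
    let τ : Equiv.Perm (Fin (n + 1)) := (Equiv.swap 0 (σ.symm A)).trans σ
    have hτ0 : τ 0 = A := by simp [τ]
    refine ⟨fun j => r (c' (τ j.succ)), ⟨c', hc', τ, hτ0 ▸ hA, fun j => rfl⟩, fun j => ?_, ?_⟩
    · rw [hc₀]
      by_cases hj : σ.symm A = j.succ
      -- The role `j` passes from `A`, which has just moved into `S`, to `σ 0`, which started in
      -- `S`: this is the situation covered by `hS`.
      · have hτj : τ j.succ = σ 0 := by simp [τ, hj]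
        have hσj : σ j.succ = A := by rw [← hj]; simp
        show Near G _ (r (c' (τ j.succ)))
        rw [hτj, hσj]
        exact hS _ hA _ hσ _ _ (hmove A) (hmove _).symm
      · have hτj : τ j.succ = σ j.succ := by
          simp only [τ, Equiv.trans_apply]
          rw [Equiv.swap_apply_of_ne_of_ne (Fin.succ_ne_zero j) (Ne.symm hj)]
        show Near G _ (r (c' (τ j.succ)))
        rw [hτj]
        exact hr _ _ (hmove _)
    -- The guard answering the attack stands outside `S`, so it is not the ignored one.
    · have hk : τ.symm k ≠ 0 := by
        intro h
        have : k = A := by rw [← hτ0, ← h]; simp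
        exact hu' (this ▸ hA)
      obtain ⟨j, hj⟩ := Fin.exists_succ_eq.2 hk
      exact ⟨j, by simp [hj]⟩

lemma eternalDominationNumber_succ_le [Finite V'] (r : V' → V) (S : Set V') (ℓ : V')
    (hr : ∀ a b, CloseAdj G' a b → CloseAdj G (r a) (r b)) (hℓ : ∀ a, Near G' a ℓ → a ∈ S)
    (hu : ∀ u, ∃ u' ∉ S, r u' = u)
    (hS : ∀ s ∈ S, ∀ s' ∈ S, ∀ a b, Near G' a s → Near G' b s' → Near G (r a) (r b)) :
    eternalDominationNumber G 2 + 1 ≤ eternalDominationNumber G' 2 := by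
  obtain ⟨F, hne, hF⟩ := exists_answers G'
  revert F
  cases hn : eternalDominationNumber G' 2 with
  | zero =>
    intro F ⟨c, hc⟩ hF
    obtain ⟨-, -, -, i, -⟩ := hF c hc ℓ
    exact i.elim0
  | succ n =>
    intro F hne hF
    obtain ⟨F₀, hne₀, hF₀⟩ := hF.drop_guard hne r S ℓ (fun _ _ => Near.map hr) hℓ hu hS
    exact Nat.succ_le_succ (eternalDominationNumber_le hne₀ hF₀)

/-- An additional guard can take care of a set of diameter at most two. -/
lemma eternalDominationNumber_le_succ_of_pairwise_near [Finite V] (f : G ↪g G') (P : Set V')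
    (hne : P.Nonempty) (hP : ∀ a ∈ P, ∀ b ∈ P, Near G' a b) (hcov : ∀ x, x ∈ P ∨ ∃ a, f a = x) :
    eternalDominationNumber G' 2 ≤ eternalDominationNumber G 2 + 1 := by
  obtain ⟨F, ⟨c₀, hc₀⟩, hF⟩ := exists_answers G
  obtain ⟨p, hp⟩ := hne
  refine eternalDominationNumber_le
    (F := {c' | ∃ c ∈ F, ∃ x ∈ P, c' = Fin.cons x (f ∘ c)}) ⟨_, c₀, hc₀, p, hp, rfl⟩ ?_
  rintro _ ⟨c, hc, x, hx, rfl⟩ v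
  rcases hcov v with hv | ⟨a, rfl⟩
  · exact ⟨_, ⟨c, hc, v, hv, rfl⟩,
      Fin.cases (hP x hx v hv) fun i => by simpa using Near.refl _, 0, rfl⟩
  · obtain ⟨c', hc', hmove, i, rfl⟩ := hF c hc a
    exact ⟨_, ⟨c', hc', x, hx, rfl⟩,
      Fin.cases (Near.refl x) fun j => by
        simpa using (hmove j).map fun _ _ => CloseAdj.map_embedding f, i.succ, by simp⟩

/-- An additional guard can take care of all vertices within distance two of a vertex `v`. -/
lemma eternalDominationNumber_le_succ_of_near [Finite V] (f : G ↪g G') (v : V)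
    (hcov : ∀ x, Near G' (f v) x ∨ ∃ a, f a = x) :
    eternalDominationNumber G' 2 ≤ eternalDominationNumber G 2 + 1 := by
  obtain ⟨F, ⟨c₀, hc₀⟩, hF⟩ := exists_answers G
  -- Invariant: the extra guard is at `f v`, or it is at some `x` near `f v` while a guard of `G`
  -- stands on `v`. The permutation `σ` is needed because these two may exchange roles.
  refine eternalDominationNumber_le
    (F := {c' | ∃ c ∈ F, ∃ σ : Equiv.Perm (Fin (_ + 1)), ∃ x, c' ∘ σ = Fin.cons x (f ∘ c) ∧
      (x = f v ∨ Near G' (f v) x ∧ ∃ i, c i = v)})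
    ⟨_, c₀, hc₀, Equiv.refl _, _, rfl, Or.inl rfl⟩ ?_
  rintro g ⟨c, hc, σ, x, hg, hx⟩ y
  have hxv : Near G' x (f v) := by
    rcases hx with rfl | ⟨h, -⟩
    · exact .refl _
    · exact h.symm
  have hg0 : g (σ 0) = x := congrFun hg 0
  have hgs : ∀ i, g (σ (Fin.succ i)) = f (c i) := fun i => by
    simpa using congrFun hg i.succ
  have lift : ∀ {a b : V}, Near G a b → Near G' (f a) (f b) := fun h =>
    h.map fun _ _ => CloseAdj.map_embedding f
  have reindex : ∀ (g' : Fin (eternalDominationNumber G 2 + 1) → V'),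
      (∀ i, Near G' (g (σ i)) (g' i)) → ∀ i, Near G' (g i) ((g' ∘ σ.symm) i) := fun g' h i => by
    simpa using h (σ.symm i)
  by_cases hy : ∃ a, f a = y
  · obtain ⟨a, rfl⟩ := hy
    obtain ⟨c', hc', hmove, i, rfl⟩ := hF c hc a
    refine ⟨Fin.cons (f v) (f ∘ c') ∘ σ.symm, ⟨c', hc', σ, f v, ?_, Or.inl rfl⟩,
      reindex _ (Fin.cases (by simpa [hg0] using hxv) fun j => ?_), σ i.succ, by simp⟩
    · ext i; simp
    · simpa [hgs] using lift (hmove j)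
  · have hvy : Near G' (f v) y := (hcov y).resolve_right hy
    -- If the extra guard is at `f v`, it goes to `y` while the others react as if `v` were
    -- attacked. Otherwise guard `i`, standing on `v`, goes to `y`, and the extra guard replaces it
    -- on `v`.
    rcases hx with rfl | ⟨-, i, hi⟩
    · obtain ⟨c', hc', hmove, i, hi⟩ := hF c hc v
      refine ⟨Fin.cons y (f ∘ c') ∘ σ.symm, ⟨c', hc', σ, y, ?_, Or.inr ⟨hvy, i, hi⟩⟩,
        reindex _ (Fin.cases (by simpa [hg0] using hvy) fun j => ?_), σ 0, by simp⟩
      · ext i; simp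
      · simpa [hgs] using lift (hmove j)
    · have hτ : ∀ g' : Fin (eternalDominationNumber G 2 + 1) → V',
          (g' ∘ ⇑((Equiv.swap 0 i.succ).trans σ).symm) ∘ ⇑((Equiv.swap 0 i.succ).trans σ) = g' :=
        fun g' => by ext; simp
      refine ⟨Fin.cons y (f ∘ c) ∘ ((Equiv.swap 0 i.succ).trans σ).symm,
        ⟨c, hc, (Equiv.swap 0 i.succ).trans σ, y, hτ _, Or.inr ⟨hvy, i, hi⟩⟩, fun k => ?_,
        σ i.succ, by simp⟩
      obtain ⟨k, rfl⟩ := σ.surjective k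
      simp only [Equiv.symm_trans_apply, Equiv.symm_swap, Function.comp_apply,
        Equiv.symm_apply_apply]
      refine Fin.cases ?_ (fun j => ?_) k
      · simpa [hg0, hi] using hxv
      · by_cases hj : j = i
        · subst hj
          simpa [hgs, hi] using hvy
        · rw [Equiv.swap_apply_of_ne_of_ne (Fin.succ_ne_zero j)
            (fun h => hj (Fin.succ_injective _ h)), hgs]
          simpa using Near.refl _

end Compare

/-! ### Attaching a graph at a vertex -/

section Attach

variable {V W X : Type*} {G : SimpleGraph V} {H : SimpleGraph W} {T : SimpleGraph X} {v : V}
  {B : Set W}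

@[simp]
lemma attach_adj_inl_inl {a b : V} :
    (attach G v H B).Adj (Sum.inl a) (Sum.inl b) ↔ G.Adj a b := by
  simp [attach]

@[simp]
lemma attach_adj_inr_inr {a b : W} :
    (attach G v H B).Adj (Sum.inr a) (Sum.inr b) ↔ H.Adj a b := by
  simp [attach]

@[simp]
lemma attach_adj_inl_inr {a : V} {b : W} :
    (attach G v H B).Adj (Sum.inl a) (Sum.inr b) ↔ a = v ∧ b ∈ B := by
  simp [attach]

@[simp]
lemma attach_adj_inr_inl {a : W} {b : V} :
    (attach G v H B).Adj (Sum.inr a) (Sum.inl b) ↔ b = v ∧ a ∈ B := by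
  rw [adj_comm, attach_adj_inl_inr]

/-- The retraction of `attach G v H B` that contracts `H` to `v`. -/
def contract (v : V) : V ⊕ W → V := Sum.elim id fun _ => v

lemma contract_closeAdj {a b : V ⊕ W} (h : CloseAdj (attach G v H B) a b) :
    CloseAdj G (contract v a) (contract v b) := by
  rcases h with rfl | h
  · exact .refl _
  · rcases a with a | a <;> rcases b with b | b <;> simp at h
    · exact Or.inr h
    · exact Or.inl h.1
    · exact Or.inl h.1.symm
    · exact Or.inl rfl

/-- Embeddings of `G` and of `H` glue to an embedding of `attach G v H B`. -/
lemma exists_attach_embedding (g : G ↪g T) (h : H ↪g T) (hdisj : ∀ a w, g a ≠ h w)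
    (hadj : ∀ a w, T.Adj (g a) (h w) ↔ a = v ∧ w ∈ B) :
    ∃ φ : attach G v H B ↪g T, (∀ a, φ (Sum.inl a) = g a) ∧ ∀ w, φ (Sum.inr w) = h w := by
  refine ⟨⟨⟨Sum.elim g h, ?_⟩, ?_⟩, fun a => rfl, fun w => rfl⟩
  · exact Function.Injective.sumElim g.injective h.injective hdisj
  · rintro (a | a) (b | b)
    · simp
    · simp [hadj]
    · simp [adj_comm, hadj]
    · simp

/-- A vertex together with pairwise non-adjacent neighbours is a star. -/
lemma exists_star_embedding {m : ℕ} (c : X) (f : Fin m → X) (hf : Function.Injective f)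
    (hc : ∀ i, T.Adj c (f i)) (hind : ∀ i j, ¬ T.Adj (f i) (f j)) :
    ∃ φ : starK m ↪g T, φ 0 = c ∧ ∀ i, φ (Fin.succ i) = f i := by
  refine ⟨⟨⟨Fin.cons c f, ?_⟩, ?_⟩, rfl, fun i => rfl⟩
  · rw [Fin.cons_injective_iff]
    exact ⟨fun ⟨i, hi⟩ => (hc i).ne hi.symm, hf⟩
  · intro a b
    refine Fin.cases ?_ (fun a => ?_) a <;> refine Fin.cases ?_ (fun b => ?_) b
    · simp
    · simp [hc, (Fin.succ_ne_zero _).symm]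
    · simp [(hc _).symm]
    · simp [hind]

end Attach

/-! ### Rooted trees -/

section Rooted

variable {V : Type u} {T : SimpleGraph V}

/-- The parent function of a tree rooted at `r`. -/
lemma exists_parent (hT : T.IsTree) (r : V) :
    ∃ par : V → V, (∀ x, x ≠ r → T.Adj x (par x) ∧ T.dist r x = T.dist r (par x) + 1) ∧
      ∀ x y, T.Adj x y → (x ≠ r ∧ par x = y) ∨ (y ≠ r ∧ par y = x) := by
  choose p hp huniq using fun x => hT.existsUnique_path r x
  have hlen : ∀ x, (p x).length = T.dist r x := fun x => by
    obtain ⟨q, hq, hql⟩ := hT.connected.exists_path_of_dist r x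
    rw [← hql, huniq x q hq]
  have hpar : ∀ x y, T.Adj x y → T.dist r x = T.dist r y + 1 → x ≠ r ∧ (p x).penultimate = y := by
    intro x y hxy hd
    refine ⟨by rintro rfl; simp at hd, ?_⟩
    have hq : ((p y).concat hxy.symm).IsPath := by
      refine Walk.isPath_of_length_eq_dist _ ?_
      rw [Walk.length_concat, hlen, hd]
    rw [← huniq x _ hq, Walk.penultimate_concat]
  refine ⟨fun x => (p x).penultimate, fun x hx => ?_, fun x y hxy => ?_⟩
  · have hnil : ¬ (p x).Nil := Walk.not_nil_of_ne (Ne.symm hx)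
    have hadj := (Walk.adj_penultimate hnil).symm
    refine ⟨hadj, ?_⟩
    rcases hT.dist_eq_dist_add_one_of_adj r hadj with h | h
    · exact h
    · exfalso
      have h₁ := dist_le (p x).dropLast
      have h₂ : (p x).dropLast.length + 1 = (p x).length := Walk.length_dropLast_add_one hnil
      rw [hlen] at h₂
      omega
  · rcases hT.dist_eq_dist_add_one_of_adj r hxy with h | h
    · exact Or.inl (hpar x y hxy h)
    · exact Or.inr (hpar y x hxy.symm h)

/-- Any neighbour other than the parent would be a child, one step farther from `r`. -/
lemma isLeaf_of_forall_dist_le (hT : T.IsTree) {r ℓ : V} (hne : ℓ ≠ r)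
    (hmax : ∀ y, T.dist r y ≤ T.dist r ℓ) : IsLeaf T ℓ := by
  obtain ⟨par, hpar, hadj⟩ := exists_parent hT r
  refine ⟨par ℓ, (hpar ℓ hne).1, fun y hy => ?_⟩
  rcases hadj _ _ hy with ⟨-, h⟩ | ⟨hyr, h⟩
  · exact h.symm
  · have := (hpar y hyr).2
    have := hmax y
    rw [h] at *
    omega

lemma near_iff_dist_le (hT : T.Connected) {a b : V} : Near T a b ↔ T.dist a b ≤ 2 := by
  rw [← edist_le_two_iff_near, ← (hT.preconnected a b).coe_dist_eq_edist, Nat.cast_le]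

lemma IsLeaf.closeAdj_of_near {v w x : V} (hv : IsLeaf T v) (hw : T.Adj v w) (h : Near T v x) :
    CloseAdj T w x := by
  obtain ⟨y, h₁, h₂⟩ := h
  rcases h₁ with rfl | h₁
  · rcases h₂ with rfl | h₂
    · exact Or.inr hw.symm
    · exact Or.inl (hv.unique hw h₂)
  · exact hv.unique hw h₁ ▸ h₂

variable [Finite V]

lemma exists_leaves_dist_eq_diam [Nontrivial V] (hT : T.IsTree) :
    ∃ a b, T.dist a b = T.diam ∧ IsLeaf T a ∧ IsLeaf T b := by
  have hd : T.ediam ≠ ⊤ := connected_iff_ediam_ne_top.1 hT.connected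
  have h0 := diam_ne_zero_of_ediam_ne_top hd
  obtain ⟨a, b, hab⟩ := T.exists_dist_eq_diam
  have hne : a ≠ b := by
    rintro rfl
    simp at hab
    omega
  exact ⟨a, b, hab,
    isLeaf_of_forall_dist_le hT (r := b) hne fun y => by
      rw [dist_comm (u := b) (v := a), hab]; exact dist_le_diam hd,
    isLeaf_of_forall_dist_le hT (r := a) hne.symm fun y => by
      rw [hab]; exact dist_le_diam hd⟩

lemma dominationNumber_le_one_of_subsingleton [Subsingleton V] : dominationNumber T ≤ 1 := by
  have := Fintype.ofFinite V
  refine (dominationNumber_le (D := Finset.univ) fun v hv => absurd (Finset.mem_univ v) hv).trans ?_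
  rw [Finset.card_univ]
  exact Fintype.card_le_one_iff_subsingleton.2 ‹_›

/-- The neighbours of two leaves at maximum distance dominate a tree of diameter at most three. -/
lemma dominationNumber_le_two_of_diam_le_three (hT : T.IsTree) (hd : T.diam ≤ 3) :
    dominationNumber T ≤ 2 := by
  classical
  rcases subsingleton_or_nontrivial V with hV | hV
  · exact dominationNumber_le_one_of_subsingleton.trans one_le_two
  obtain ⟨a, b, hab, ha, hb⟩ := exists_leaves_dist_eq_diam hT
  obtain ⟨x, hx, -⟩ := id ha
  obtain ⟨s, hs, -⟩ := id hb
  have htop : T.ediam ≠ ⊤ := connected_iff_ediam_ne_top.1 hT.connected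
  refine (dominationNumber_le (D := {x, s}) ?_).trans Finset.card_le_two
  rw [isDominating_iff]
  intro y
  by_cases hay : Near T a y
  · exact ⟨x, by simp, ha.closeAdj_of_near hx hay⟩
  by_cases hby : Near T b y
  · exact ⟨s, by simp, hb.closeAdj_of_near hs hby⟩
  rw [near_iff_dist_le hT.connected] at hay hby
  have h₁ := dist_le_diam htop (u := a) (v := y)
  have h₂ := dist_le_diam htop (u := b) (v := y)
  obtain ⟨p, hp⟩ := hT.connected.exists_walk_length_eq_dist b y
  have hp3 : p.length = 3 := by omega
  match p, hp3 with
  -- Parity: `a`, `b`, `y` would be pairwise at distance 3, but the distance to `a` changes by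
  -- exactly one along each of the three edges from `b` to `y`.
  | .cons e₁ (.cons e₂ (.cons e₃ .nil)), _ =>
    have := hT.dist_eq_dist_add_one_of_adj a e₁
    have := hT.dist_eq_dist_add_one_of_adj a e₂
    have := hT.dist_eq_dist_add_one_of_adj a e₃
    omega

lemma dominationNumber_le_one_of_near (hT : T.IsTree) (h : ∀ a b, Near T a b) :
    dominationNumber T ≤ 1 := by
  rcases subsingleton_or_nontrivial V with hV | hV
  · exact dominationNumber_le_one_of_subsingleton
  obtain ⟨a, -, -, ha, -⟩ := exists_leaves_dist_eq_diam hT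
  obtain ⟨x, hx, -⟩ := id ha
  refine (dominationNumber_le (D := {x}) ?_).trans (by simp)
  rw [isDominating_iff]
  exact fun y => ⟨x, by simp, ha.closeAdj_of_near hx (h a y)⟩

end Rooted

/-! ### Members of the family -/

section Forward

variable {V : Type u} {G : SimpleGraph V}

lemma one_le_eternalDominationNumber [Finite V] [Nonempty V] (G : SimpleGraph V) :
    1 ≤ eternalDominationNumber G 2 := by
  by_contra h
  obtain ⟨F, ⟨c, hc⟩, hF⟩ := exists_answers G
  obtain ⟨-, -, -, i, -⟩ := hF c hc (Classical.arbitrary V)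
  exact absurd i.isLt (by omega)

/-- A lone guard has to answer an attack at `a` followed by one at `b`. -/
lemma near_of_eternalDominationNumber_le_one [Finite V]
    (h : eternalDominationNumber G 2 ≤ 1) (a b : V) : Near G a b := by
  obtain ⟨F, ⟨c, hc⟩, hF⟩ := exists_answers G
  have : Subsingleton (Fin (eternalDominationNumber G 2)) := Fin.subsingleton_iff_le_one.2 h
  obtain ⟨c₁, hc₁, -, i, rfl⟩ := hF c hc a
  obtain ⟨c₂, -, hmove, j, rfl⟩ := hF c₁ hc₁ b
  rw [Subsingleton.elim j i]
  exact hmove i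

lemma dominationNumber_le_eternalDominationNumber_of_diam_le_three [Finite V] (hG : G.IsTree)
    (hd : G.diam ≤ 3) : dominationNumber G ≤ eternalDominationNumber G 2 := by
  have := hG.connected.nonempty
  have h₁ := one_le_eternalDominationNumber G
  by_cases h : eternalDominationNumber G 2 ≤ 1
  · exact (dominationNumber_le_one_of_near hG (near_of_eternalDominationNumber_le_one h)).trans h₁
  · have := dominationNumber_le_two_of_diam_le_three hG hd
    omega

lemma eternalDominationNumber_le_of_iso {W : Type u} [Finite W] {H : SimpleGraph W} (e : G ≃g H) :
    eternalDominationNumber G 2 ≤ eternalDominationNumber H 2 := by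
  obtain ⟨F, ⟨c₀, hc₀⟩, hF⟩ := exists_answers H
  refine eternalDominationNumber_le (F := {c | e ∘ c ∈ F})
    ⟨e.symm ∘ c₀, by simpa [← Function.comp_assoc] using hc₀⟩ ?_
  intro c hc v
  obtain ⟨c', hc', hmove, i, hi⟩ := hF _ hc (e v)
  refine ⟨e.symm ∘ c', by simpa [← Function.comp_assoc] using hc', fun j => ?_, i, by simp [hi]⟩
  simpa using (hmove j).map fun _ _ => CloseAdj.map_embedding e.symm.toEmbedding

/-- Since `v ∈ D` already dominates the new leaves, only the centre of the star is added. -/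
lemma dominationNumber_appendStarLeaves_le {v : V} {D : Finset V} (hD : IsMinDominating G D)
    (hv : v ∈ D) (m t : ℕ) :
    dominationNumber (attach (attach G v (starK m) {0}) (Sum.inl v)
      (⊥ : SimpleGraph (Fin t)) Set.univ) ≤ dominationNumber G + 1 := by
  classical
  obtain ⟨hD, hc⟩ := hD
  rw [← hc]
  refine (dominationNumber_le
    (D := insert (Sum.inl (Sum.inr 0)) (D.image (Sum.inl ∘ Sum.inl))) ?_).trans
    ((Finset.card_insert_le _ _).trans (Nat.succ_le_succ Finset.card_image_le))
  rw [isDominating_iff] at hD ⊢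
  rintro ((a | b) | b)
  · obtain ⟨w, hw, hwa⟩ := hD a
    exact ⟨Sum.inl (Sum.inl w), by simp [hw], hwa.imp (fun h => by rw [h]) fun h => by simpa using h⟩
  · refine ⟨Sum.inl (Sum.inr 0), by simp, ?_⟩
    by_cases hb : b = 0
    · exact Or.inl (by rw [hb])
    · exact Or.inr (by simpa using Ne.symm hb)
  · exact ⟨Sum.inl (Sum.inl v), by simp [hv], Or.inr (by simp)⟩

variable [Finite V]

lemma dominationNumber_appendStar_le (x : V) (m : ℕ) :
    dominationNumber (attach G x (starK m) {Fin.last m}) ≤ dominationNumber G + 1 := by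
  classical
  obtain ⟨D, hD, hc⟩ := exists_isMinDominating G
  rw [← hc]
  refine (dominationNumber_le (D := insert (Sum.inr 0) (D.image Sum.inl)) ?_).trans
    ((Finset.card_insert_le _ _).trans (Nat.succ_le_succ Finset.card_image_le))
  rw [isDominating_iff] at hD ⊢
  rintro (a | b)
  · obtain ⟨w, hw, hwa⟩ := hD a
    exact ⟨Sum.inl w, by simp [hw], hwa.imp (congrArg _) (by simp)⟩
  · refine ⟨Sum.inr 0, by simp, ?_⟩
    by_cases hb : b = 0
    · exact Or.inl (by rw [hb])
    · exact Or.inr (by simpa using Ne.symm hb)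

/-- The star is joined to `G` only at `x`, so whatever is within distance two of it contracts into
the closed neighbourhood of `x`, where any two vertices are near. -/
lemma eternalDominationNumber_appendStar (x : V) {m : ℕ} (hm : 2 ≤ m) :
    eternalDominationNumber G 2 + 1 ≤
      eternalDominationNumber (attach G x (starK m) {Fin.last m}) 2 := by
  have key : ∀ (a : V ⊕ Fin (m + 1)) (b : Fin (m + 1)),
      Near (attach G x (starK m) {Fin.last m}) a (Sum.inr b) → CloseAdj G (contract x a) x := by
    rintro (a | a) b ⟨w, h₁, h₂⟩
    · rcases w with w | w
      · have hw : w = x := by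
          have : w = x ∧ b = Fin.last m := by simpa [CloseAdj] using h₂
          exact this.1
        subst hw
        exact contract_closeAdj h₁
      · have : a = x ∧ w = Fin.last m := by simpa [CloseAdj] using h₁
        exact Or.inl this.1
    · exact Or.inl rfl
  -- As `m ≥ 2`, vertex `1` is a leaf of the star other than the attaching one, and everything
  -- within distance two of it lies in the star.
  refine eternalDominationNumber_succ_le (contract x) (Set.range Sum.inr)
    (Sum.inr ⟨1, by omega⟩) (fun _ _ => contract_closeAdj) ?_ (fun u => ⟨Sum.inl u, by simp, rfl⟩)
    ?_
  · have hm₁ : (⟨1, by omega⟩ : Fin (m + 1)) ≠ Fin.last m := by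
      rw [Ne, Fin.ext_iff, Fin.val_last]
      exact (by omega : (1 : ℕ) ≠ m)
    have hm₀ : (⟨1, by omega⟩ : Fin (m + 1)) ≠ 0 := by
      rw [Ne, Fin.ext_iff]
      exact one_ne_zero
    rintro (a | a) ⟨w, h₁, h₂⟩
    · exfalso
      rcases w with w | w
      · have : w = x ∧ (⟨1, by omega⟩ : Fin (m + 1)) = Fin.last m := by simpa [CloseAdj] using h₂
        exact hm₁ this.2
      · have hw : a = x ∧ w = Fin.last m := by simpa [CloseAdj] using h₁
        rw [hw.2] at h₂
        rcases h₂ with h₂ | h₂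
        · exact hm₁ (Sum.inr_injective h₂).symm
        · rw [attach_adj_inr_inr, starGraph_adj] at h₂
          rcases h₂.2 with h | h
          · rw [Fin.ext_iff, Fin.val_last] at h
            simp at h
            omega
          · exact hm₀ h
    · exact ⟨a, rfl⟩
  · rintro _ ⟨s, rfl⟩ _ ⟨s', rfl⟩ a b ha hb
    exact ⟨x, key a s ha, (key b s' hb).symm⟩

/-- Appending to a leaf `v` a star at its centre and further vertices forces an additional guard. -/
lemma eternalDominationNumber_append_of_isLeaf {W : Type} [Finite W] {v : V} (hv : IsLeaf G v)
    {m : ℕ} (hm : 1 ≤ m) (H : SimpleGraph W) (B : Set W) (w₀ : W) :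
    eternalDominationNumber G 2 + 1 ≤
      eternalDominationNumber (attach (attach G v (starK m) {0}) (Sum.inl v) H B) 2 := by
  have hr : ∀ a b, CloseAdj (attach (attach G v (starK m) {0}) (Sum.inl v) H B) a b →
      CloseAdj G (contract v (contract (Sum.inl v) a)) (contract v (contract (Sum.inl v) b)) :=
    fun a b h => contract_closeAdj (contract_closeAdj h)
  have hm₀ : Fin.last m ≠ 0 := by
    rw [Ne, Fin.ext_iff, Fin.val_last]
    exact (by omega : m ≠ 0)
  -- Here `v` is within distance two of the leaves of the star and must belong to `S`. All of `S`
  -- contracts to `v`, so being a leaf of `G` is what makes the vertices near it pairwise near.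
  let S : Set ((V ⊕ Fin (m + 1)) ⊕ W) := insert (Sum.inl (Sum.inl v)) (Set.range (Sum.inl ∘ Sum.inr))
  have hS : ∀ s ∈ S, contract v (contract (Sum.inl v) s) = v := by
    rintro _ (rfl | ⟨s, rfl⟩) <;> rfl
  refine eternalDominationNumber_succ_le (fun a => contract v (contract (Sum.inl v) a)) S
    (Sum.inl (Sum.inr (Fin.last m))) hr ?_ ?_ ?_
  · have hadj : ∀ w, CloseAdj (attach (attach G v (starK m) {0}) (Sum.inl v) H B) w
        (Sum.inl (Sum.inr (Fin.last m))) →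
        w = Sum.inl (Sum.inr (Fin.last m)) ∨ w = Sum.inl (Sum.inr 0) := by
      rintro ((w | w) | w) (h | h)
      · exact Or.inl h
      · simp [hm₀] at h
      · exact Or.inl h
      · simp only [attach_adj_inl_inl, attach_adj_inr_inr, starGraph_adj] at h
        rcases h.2 with h | h
        · exact Or.inr (by rw [h])
        · exact absurd h hm₀
      · exact Or.inl h
      · simp at h
    have hadj₀ : ∀ w (b : Fin (m + 1)), CloseAdj (attach (attach G v (starK m) {0}) (Sum.inl v) H B)
        w (Sum.inl (Sum.inr b)) → w ∈ S := by
      rintro ((w | w) | w) b (h | h)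
      · simp at h
      · simp at h
        exact Or.inl (by rw [h.1])
      · exact Or.inr ⟨w, rfl⟩
      · exact Or.inr ⟨w, rfl⟩
      · simp at h
      · simp at h
    rintro a ⟨w, h₁, h₂⟩
    rcases hadj w h₂ with rfl | rfl
    · exact hadj₀ _ _ h₁
    · exact hadj₀ _ _ h₁
  · intro u
    by_cases hu : u = v
    -- An attack at `v` is simulated by one at `w₀`, which lies outside `S`; this is the role of the
    -- further appended vertices.
    · exact ⟨Sum.inr w₀, by simp [S], hu.symm⟩
    · exact ⟨Sum.inl (Sum.inl u), by simp [S, hu], rfl⟩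
  · intro s hs s' hs' a b ha hb
    have ha' := ha.map hr
    have hb' := hb.map hr
    rw [hS _ hs] at ha'
    rw [hS _ hs'] at hb'
    exact hv.near_of_near ha' hb'

/-- The two new centres also dominate `v`, so it suffices to start from a dominating set of `G - v`.
-/
lemma dominationNumber_appendTwoStars_le (v : V) (m M : ℕ) :
    dominationNumber (attach (attach G v (starK m) {0}) (Sum.inl v) (starK M) {0}) ≤
      dominationNumber (G.induce {v}ᶜ) + 2 := by
  classical
  obtain ⟨D, hD, hc⟩ := exists_isMinDominating (G.induce {v}ᶜ)
  rw [← hc]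
  refine (dominationNumber_le (D := insert (Sum.inl (Sum.inr 0)) (insert (Sum.inr 0)
    (D.image fun w : ({v}ᶜ : Set V) => Sum.inl (Sum.inl w.1)))) ?_).trans
    ((Finset.card_insert_le _ _).trans (Nat.succ_le_succ ((Finset.card_insert_le _ _).trans
      (Nat.succ_le_succ Finset.card_image_le))))
  rw [isDominating_iff] at hD ⊢
  rintro ((a | b) | b)
  · by_cases ha : a = v
    · exact ⟨Sum.inr 0, by simp, Or.inr (by simp [ha])⟩
    · obtain ⟨w, hw, hwa⟩ := hD ⟨a, ha⟩
      refine ⟨Sum.inl (Sum.inl (w : V)), ?_, hwa.imp (fun h => by rw [h]) (by simp)⟩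
      exact Finset.mem_insert_of_mem (Finset.mem_insert_of_mem (Finset.mem_image_of_mem _ hw))
  · refine ⟨Sum.inl (Sum.inr 0), by simp, ?_⟩
    by_cases hb : b = 0
    · exact Or.inl (by rw [hb])
    · exact Or.inr (by simpa using Ne.symm hb)
  · refine ⟨Sum.inr 0, by simp, ?_⟩
    by_cases hb : b = 0
    · exact Or.inl (by rw [hb])
    · exact Or.inr (by simpa using Ne.symm hb)

lemma dominationNumber_le_of_iso {W : Type u} {H : SimpleGraph W} (e : G ≃g H) :
    dominationNumber H ≤ dominationNumber G := by
  classical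
  obtain ⟨D, hD, hc⟩ := exists_isMinDominating G
  rw [← hc]
  refine (dominationNumber_le (D := D.image e) ?_).trans Finset.card_image_le
  rw [isDominating_iff] at hD ⊢
  intro x
  obtain ⟨w, hw, hwx⟩ := hD (e.symm x)
  refine ⟨e w, Finset.mem_image_of_mem _ hw, ?_⟩
  simpa using hwx.map_embedding e.toEmbedding

end Forward

/-- Members of the family need as many guards as their domination number. -/
lemma TreeFamily.finite_and_dominationNumber_le {V : Type u} {G : SimpleGraph V}
    (h : TreeFamily G) : Finite V ∧ dominationNumber G ≤ eternalDominationNumber G 2 := by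
  induction h with
  | small G hG hd =>
    exact ⟨‹_›, dominationNumber_le_eternalDominationNumber_of_diam_le_three hG hd⟩
  | appendStar G hG x m hm ih =>
    obtain ⟨_, ih⟩ := ih
    exact ⟨inferInstance, (dominationNumber_appendStar_le x m).trans
      ((Nat.succ_le_succ ih).trans (eternalDominationNumber_appendStar x hm))⟩
  | appendStarLeaves G hG v hv hD m t hm ht ih =>
    obtain ⟨_, ih⟩ := ih
    obtain ⟨D, hD, hvD⟩ := hD
    exact ⟨inferInstance, (dominationNumber_appendStarLeaves_le hD hvD m t).trans
      ((Nat.succ_le_succ ih).trans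
        (eternalDominationNumber_append_of_isLeaf hv hm _ _ ⟨0, ht⟩))⟩
  | appendTwoStars G hG v hv hγ m M hm hM ih =>
    obtain ⟨_, ih⟩ := ih
    refine ⟨inferInstance, (dominationNumber_appendTwoStars_le v m M).trans ?_⟩
    exact (Nat.succ_le_succ (hγ.trans_le ih)).trans
      (eternalDominationNumber_append_of_isLeaf hv hm _ _ 0)
  | iso G H hG e ih =>
    obtain ⟨_, ih⟩ := ih
    have := Finite.of_equiv _ e.toEquiv
    exact ⟨this, (dominationNumber_le_of_iso e).trans
      (ih.trans (eternalDominationNumber_le_of_iso e))⟩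

/-! ### Decomposing a tree -/

/-- The end of a branch of a tree: `q` is a vertex with parent `x` and set of children `C`, and `L`
is the set of children of the vertices in `C`, all of which are leaves. -/
structure Branch {V : Type u} (T : SimpleGraph V) (par : V → V) (q x : V) (C L : Set V) :
    Prop where
  disjoint : ∀ y ∈ C, y ∉ L
  q_notMem_C : q ∉ C
  q_notMem_L : q ∉ L
  x_notMem_C : x ∉ C
  x_notMem_L : x ∉ L
  par_mem : ∀ y ∈ L, par y ∈ C
  adj_L : ∀ y ∈ L, ∀ z, T.Adj y z ↔ z = par y
  adj_C : ∀ c ∈ C, ∀ z, T.Adj c z ↔ z = q ∨ z ∈ L ∧ par z = c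
  adj_q : ∀ z, T.Adj q z ↔ z = x ∨ z ∈ C
  isTree_compl : (T.induce (C ∪ L)ᶜ).IsTree
  isTree_compl_insert : (T.induce (insert q (C ∪ L))ᶜ).IsTree
  nonempty : L.Nonempty

section Rooted

variable {V : Type u} {T : SimpleGraph V}

/-- A set closed under taking parents contains the path from each of its vertices to the root. -/
lemma isTree_induce_of_parent (hT : T.IsTree) {r : V} {par : V → V}
    (hpar : ∀ x, x ≠ r → T.Adj x (par x) ∧ T.dist r x = T.dist r (par x) + 1)
    {A : Set V} (hr : r ∈ A) (hA : ∀ a ∈ A, a ≠ r → par a ∈ A) : (T.induce A).IsTree := by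
  have key : ∀ n, ∀ a (ha : a ∈ A), T.dist r a = n → (T.induce A).Reachable ⟨a, ha⟩ ⟨r, hr⟩ := by
    intro n
    induction n with
    | zero =>
      intro a ha h
      obtain rfl := (hT.connected.dist_eq_zero_iff).1 h
      exact .refl _
    | succ n ih =>
      intro a ha h
      have hne : a ≠ r := by rintro rfl; simp at h
      have hadj : (T.induce A).Adj ⟨a, ha⟩ ⟨par a, hA a ha hne⟩ := (hpar a hne).1
      exact hadj.reachable.trans (ih _ _ (by have := (hpar a hne).2; omega))
  have : Nonempty A := ⟨⟨r, hr⟩⟩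
  exact ⟨⟨fun a b => (key _ a a.2 rfl).trans (key _ b b.2 rfl).symm⟩, hT.isAcyclic.induce A⟩

/-- With the root at an end of a longest path, a deepest vertex `ℓ` has depth at least 4. By its
maximal depth, no grandchild of its grandparent `q` has children. -/
lemma exists_branch [Finite V] (hT : T.IsTree) (hd : 3 < T.diam) :
    ∃ par q x C L, Branch T par q x C L := by
  have := hT.connected.nonempty
  obtain ⟨r, b, hrb⟩ := T.exists_dist_eq_diam
  obtain ⟨ℓ, hℓ⟩ := Finite.exists_max (T.dist r)
  have hℓ3 : 3 < T.dist r ℓ := by have := hℓ b; omega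
  obtain ⟨par, hpar, hadj⟩ := exists_parent hT r
  have ne_of_dist : ∀ {y}, 0 < T.dist r y → y ≠ r := fun h e => by simp [e] at h
  have d₁ := hpar ℓ (ne_of_dist (by omega))
  have d₂ := hpar (par ℓ) (ne_of_dist (by omega))
  have d₃ := hpar (par (par ℓ)) (ne_of_dist (by omega))
  generalize hq : par (par ℓ) = q at *
  have hC : ∀ c, c ≠ r ∧ par c = q → T.dist r c = T.dist r q + 1 := fun c hc => by
    have := (hpar c hc.1).2
    rwa [hc.2] at this
  have hL : ∀ y, y ≠ r ∧ par y ≠ r ∧ par (par y) = q → T.dist r y = T.dist r q + 2 :=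
    fun y hy => by
      have := (hpar y hy.1).2
      have := hC _ hy.2
      omega
  have hchild : ∀ y z, y ≠ r → par y ≠ r → par (par y) = q → z ≠ r → par z ≠ y := by
    rintro y z hy hy' hyq hz rfl
    have := (hpar z hz).2
    have := hL _ ⟨hy, hy', hyq⟩
    have := hℓ z
    omega
  -- The value `par r` carries no meaning, hence the conditions `≠ r`.
  refine ⟨par, q, par q, {c | c ≠ r ∧ par c = q}, {y | y ≠ r ∧ par y ≠ r ∧ par (par y) = q},
    ?_, ?_, ?_, ?_, ?_, fun y hy => hy.2, ?_, ?_, ?_, ?_, ?_,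
    ⟨ℓ, ne_of_dist (by omega), ne_of_dist (by omega), hq⟩⟩
  · intro y hy hy'
    have := hC y hy
    have := hL y hy'
    omega
  · intro h
    have := hC q h
    omega
  · intro h
    have := hL q h
    omega
  · intro h
    have := hC _ h
    omega
  · intro h
    have := hL _ h
    omega
  · rintro y ⟨hy, hy', hyq⟩ z
    refine ⟨fun h => ?_, fun h => h ▸ (hpar y hy).1⟩
    rcases hadj _ _ h with h | h
    · exact h.2.symm
    · exact absurd h.2 (hchild y z hy hy' hyq h.1)
  · rintro c ⟨hc, hcq⟩ z
    constructor
    · intro h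
      rcases hadj _ _ h with h | h
      · exact Or.inl (h.2.symm.trans hcq)
      · obtain ⟨hz, rfl⟩ := h
        exact Or.inr ⟨⟨hz, hc, hcq⟩, rfl⟩
    · rintro (rfl | ⟨⟨hz, -⟩, rfl⟩)
      · exact hcq ▸ (hpar c hc).1
      · exact (hpar z hz).1.symm
  · intro z
    constructor
    · intro h
      rcases hadj _ _ h with h | h
      · exact Or.inl h.2.symm
      · exact Or.inr h
    · rintro (rfl | ⟨hz, hzq⟩)
      · exact d₃.1
      · exact hzq ▸ (hpar z hz).1.symm
  · refine isTree_induce_of_parent hT hpar (by simp) fun a ha har => ?_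
    simp only [Set.mem_compl_iff, Set.mem_union, Set.mem_ofPred_eq, not_or] at ha ⊢
    refine ⟨fun h => ha.2 ⟨har, h⟩, fun h => ?_⟩
    exact hchild (par a) a h.1 h.2.1 h.2.2 har rfl
  · have hqr : q ≠ r := ne_of_dist (by omega)
    refine isTree_induce_of_parent hT hpar (by simp [hqr.symm]) fun a ha har => ?_
    simp only [Set.mem_compl_iff, Set.mem_insert_iff, Set.mem_union, Set.mem_ofPred_eq,
      not_or] at ha ⊢
    refine ⟨fun h => ha.2.1 ⟨har, h⟩, fun h => ha.2.2 ⟨har, h⟩, fun h => ?_⟩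
    exact hchild (par a) a h.1 h.2.1 h.2.2 har rfl

end Rooted

section Enumerate

lemma exists_enumeration {V : Type*} [Finite V] (L : Set V) :
    ∃ (k : ℕ) (f : Fin k → V), Function.Injective f ∧ ∀ y, y ∈ L ↔ ∃ i, f i = y := by
  obtain ⟨k, ⟨e⟩⟩ := Finite.exists_equiv_fin L
  refine ⟨k, fun i => e.symm i, Subtype.val_injective.comp e.symm.injective, fun y => ?_⟩
  exact ⟨fun hy => ⟨e ⟨y, hy⟩, by simp⟩, fun ⟨i, hi⟩ => hi ▸ (e.symm i).2⟩

end Enumerate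

/-! ### Restricting dominating sets to a part with a single exit -/

section InduceDomination

variable {V : Type u} {T : SimpleGraph V}

/-- Restriction of a dominating set to `A`, when all edges leaving `A` start at `v`: the members
outside `A` may be replaced by `v`. -/
lemma exists_isDominating_induce {A : Set V} {v : V} (hv : v ∈ A)
    (hA : ∀ a ∈ A, ∀ b ∉ A, T.Adj a b → a = v) {D E : Finset V} (hD : IsDominating T D)
    (hDE : ∀ w ∈ D, w ∈ A → w ∈ E)
    (hE : (∃ w ∈ D, w ∉ A ∧ T.Adj w v) → ∃ d ∈ E, d = v ∨ d ∉ A) :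
    ∃ D₀ : Finset A, IsDominating (T.induce A) D₀ ∧ D₀.card ≤ E.card ∧
      ((∃ d ∈ E, d = v ∨ d ∉ A) → ⟨v, hv⟩ ∈ D₀) := by
  classical
  -- Outside `A`, a member of `D` can dominate only `v` within `A`, so moving it to `v` loses
  -- nothing.
  let ret : V → A := fun y => if h : y ∈ A then ⟨y, h⟩ else ⟨v, hv⟩
  have hmem : (∃ d ∈ E, d = v ∨ d ∉ A) → ⟨v, hv⟩ ∈ E.image ret := by
    rintro ⟨d, hd, hdv⟩
    refine Finset.mem_image.2 ⟨d, hd, ?_⟩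
    rcases hdv with rfl | hdA
    · simp [ret, hv]
    · simp [ret, hdA]
  refine ⟨E.image ret, ?_, Finset.card_image_le, hmem⟩
  rw [isDominating_iff] at hD ⊢
  rintro ⟨a, ha⟩
  obtain ⟨w, hw, hwa⟩ := hD a
  by_cases hwA : w ∈ A
  · refine ⟨⟨w, hwA⟩, Finset.mem_image.2 ⟨w, hDE w hw hwA, by simp [ret, hwA]⟩, ?_⟩
    exact hwa.imp Subtype.ext id
  · have hadj : T.Adj w a := hwa.resolve_left (by rintro rfl; exact hwA ha)
    obtain rfl := hA a ha w hwA hadj.symm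
    exact ⟨_, hmem (hE ⟨w, hw, hwA, hadj⟩), .refl _⟩

/-- A dominating set avoiding `v` dominates `A \ {v}` when all edges leaving `A` start at `v`. -/
lemma dominationNumber_induce_induce_le {A : Set V} {v : V} (hv : v ∈ A)
    (hA : ∀ a ∈ A, ∀ b ∉ A, T.Adj a b → a = v) {D E : Finset V} (hD : IsDominating T D)
    (hDE : ∀ w ∈ D, w ∈ A → w ∈ E) (hvD : v ∉ D) :
    dominationNumber ((T.induce A).induce {⟨v, hv⟩}ᶜ) ≤ E.card := by
  classical
  refine (dominationNumber_le (D := (D.subtype (· ∈ A)).subtype (· ∈ ({⟨v, hv⟩}ᶜ : Set A)))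
    ?_).trans (Finset.card_le_card_of_injOn (fun y => (y : A).1) ?_ ?_)
  · rw [isDominating_iff] at hD ⊢
    rintro ⟨⟨a, ha⟩, hav⟩
    have hav' : a ≠ v := fun h => hav (Subtype.ext h)
    obtain ⟨w, hw, hwa⟩ := hD a
    have hwA : w ∈ A := by
      by_contra hwA
      rcases hwa with rfl | hwa
      · exact hwA ha
      · exact hav' (hA a ha w hwA hwa.symm)
    have hwv : (⟨w, hwA⟩ : A) ∈ ({⟨v, hv⟩}ᶜ : Set A) := fun h => by
      have : w = v := congrArg Subtype.val h
      exact hvD (this ▸ hw)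
    exact ⟨⟨⟨w, hwA⟩, hwv⟩, by simpa using hw, hwa.imp (fun h => Subtype.ext (Subtype.ext h)) id⟩
  · rintro ⟨⟨a, ha⟩, hav⟩ h
    simp only [Finset.mem_coe, Finset.mem_subtype] at h
    exact hDE a h ha
  · exact fun a _ b _ h => Subtype.ext (Subtype.ext h)

end InduceDomination

/-! ### Undoing an operation at the end of a branch -/

namespace Branch

variable {V : Type u} {T : SimpleGraph V} {par : V → V} {q x : V} {C L : Set V}

lemma q_mem (hB : Branch T par q x C L) : q ∈ (C ∪ L)ᶜ := fun h =>
  h.elim hB.q_notMem_C hB.q_notMem_L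

lemma x_ne_q (hB : Branch T par q x C L) : x ≠ q := fun h =>
  ((hB.adj_q x).2 (Or.inl rfl)).ne h.symm

lemma x_mem (hB : Branch T par q x C L) : x ∈ (insert q (C ∪ L))ᶜ := fun h =>
  h.elim hB.x_ne_q fun h => h.elim hB.x_notMem_C hB.x_notMem_L

lemma x_mem' (hB : Branch T par q x C L) : x ∈ (C ∪ L)ᶜ := fun h =>
  hB.x_mem (Or.inr h)

lemma eq_q_of_adj (hB : Branch T par q x C L) {a b : V} (ha : a ∈ (C ∪ L)ᶜ) (hb : b ∉ (C ∪ L)ᶜ)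
    (h : T.Adj a b) : a = q := by
  rcases not_not.1 hb with hb | hb
  · rcases (hB.adj_C b hb a).1 h.symm with h | h
    · exact h
    · exact absurd (Or.inr h.1) ha
  · rw [(hB.adj_L b hb a).1 h.symm] at ha
    exact absurd (Or.inl (hB.par_mem b hb)) ha

lemma eq_x_of_adj (hB : Branch T par q x C L) {a b : V} (ha : a ∈ (insert q (C ∪ L))ᶜ)
    (hb : b ∉ (insert q (C ∪ L))ᶜ) (h : T.Adj a b) : b = q ∧ a = x := by
  have ha' : a ∈ (C ∪ L)ᶜ := fun h => ha (Or.inr h)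
  rcases not_not.1 hb with rfl | hb
  · exact ⟨rfl, ((hB.adj_q a).1 h.symm).resolve_right fun h => ha' (Or.inl h)⟩
  · exact absurd (Or.inl (hB.eq_q_of_adj ha' (not_not.2 hb) h)) ha

/-- The vertices below a child `c` of `q`, together with `c`, form a star. -/
lemma exists_star (hB : Branch T par q x C L) [Finite V] {c : V} (hc : c ∈ C) :
    ∃ (m : ℕ) (φ : starK m ↪g T), φ 0 = c ∧ (∀ i, i ≠ 0 → φ i ∈ L ∧ par (φ i) = c) ∧
      ∀ y ∈ L, par y = c → 1 ≤ m ∧ ∃ i, φ i = y := by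
  obtain ⟨m, f, hf, hL⟩ := exists_enumeration {y | y ∈ L ∧ par y = c}
  have hfL : ∀ i, f i ∈ L ∧ par (f i) = c := fun i => (hL (f i)).2 ⟨i, rfl⟩
  obtain ⟨φ, h0, hφ⟩ := exists_star_embedding (T := T) c f hf
    (fun i => (hB.adj_C c hc _).2 (Or.inr (hfL i))) fun i j h => by
      exact hB.disjoint _ (hB.par_mem _ (hfL i).1) ((hB.adj_L _ (hfL i).1 _).1 h ▸ (hfL j).1)
  refine ⟨m, φ, h0, fun i hi => ?_, fun y hy hyc => ?_⟩
  · obtain ⟨j, rfl⟩ := Fin.exists_succ_eq.2 hi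
    exact hφ j ▸ hfL j
  · obtain ⟨i, rfl⟩ := (hL y).1 ⟨hy, hyc⟩
    exact ⟨i.pos, i.succ, hφ i⟩

lemma exists_mem_of_isDominating (hB : Branch T par q x C L) {D : Finset V}
    (hD : IsDominating T D) {c : V} (hc : c ∈ C) :
    ∃ d ∈ D, d = c ∨ d = q ∨ d ∈ L ∧ par d = c := by
  obtain ⟨d, hd, rfl | h⟩ := isDominating_iff.1 hD c
  · exact ⟨d, hd, Or.inl rfl⟩
  · exact ⟨d, hd, Or.inr ((hB.adj_C c hc d).1 h.symm)⟩

/-- The member found is never `q`: each child of `q` that has children costs a dominating set a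
vertex of its own. -/
lemma exists_mem_of_isDominating_of_mem (hB : Branch T par q x C L) {D : Finset V}
    (hD : IsDominating T D) {y : V} (hy : y ∈ L) :
    ∃ d ∈ D, d = par y ∨ d ∈ L ∧ par d = par y := by
  obtain ⟨d, hd, rfl | h⟩ := isDominating_iff.1 hD y
  · exact ⟨d, hd, Or.inr ⟨hy, rfl⟩⟩
  · exact ⟨d, hd, Or.inl ((hB.adj_L y hy d).1 h.symm)⟩

lemma isLeaf_q (hB : Branch T par q x C L) :
    IsLeaf (T.induce (C ∪ L)ᶜ) ⟨q, hB.q_mem⟩ := by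
  refine ⟨⟨x, hB.x_mem'⟩, (hB.adj_q x).2 (Or.inl rfl), ?_⟩
  rintro ⟨y, hy⟩ h
  exact Subtype.ext (((hB.adj_q y).1 h).resolve_right fun h => hy (Or.inl h))

variable [Finite V]

/-- Everything in `C ∪ L` is within distance two of `q`, which remains in the smaller tree. -/
lemma eternalDominationNumber_le (hB : Branch T par q x C L) :
    eternalDominationNumber T 2 ≤ eternalDominationNumber (T.induce (C ∪ L)ᶜ) 2 + 1 := by
  refine eternalDominationNumber_le_succ_of_near (Embedding.induce _) ⟨q, hB.q_mem⟩ fun y => ?_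
  by_cases hy : y ∈ (C ∪ L)ᶜ
  · exact Or.inr ⟨⟨y, hy⟩, rfl⟩
  left
  show Near T q y
  rcases not_not.1 hy with hy | hy
  · exact CloseAdj.near (Or.inr ((hB.adj_q y).2 (Or.inr hy)))
  · exact ⟨par y, Or.inr ((hB.adj_q _).2 (Or.inr (hB.par_mem y hy))),
      Or.inr ((hB.adj_L y hy _).2 rfl).symm⟩

/-- If `q` has a single child, then the branch is a star appended by a leaf. -/
lemma treeFamily_of_subsingleton (hB : Branch T par q x C L) (hC : C.Subsingleton)
    (heq : dominationNumber T ≤ eternalDominationNumber T 2)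
    (ih : ∀ A : Set V, A ≠ Set.univ → (T.induce A).IsTree →
      dominationNumber (T.induce A) ≤ eternalDominationNumber (T.induce A) 2 →
      TreeFamily (T.induce A)) : TreeFamily T := by
  classical
  obtain ⟨ℓ, hℓ⟩ := hB.nonempty
  obtain ⟨s, hs⟩ : ∃ s, s ∈ C := ⟨_, hB.par_mem ℓ hℓ⟩
  have hpar : ∀ y ∈ L, par y = s := fun y hy => hC (hB.par_mem y hy) hs
  let A : Set V := (insert q (C ∪ L))ᶜ
  have hsA : s ∉ A := fun h => h (Or.inr (Or.inl hs))
  have hqA : q ∉ A := fun h => h (Or.inl rfl)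
  have hLA : ∀ y ∈ L, y ∉ A := fun y hy h => h (Or.inr (Or.inr hy))
  have hclose : ∀ y, y ∉ A → CloseAdj T y s := by
    intro y hy
    rcases not_not.1 hy with rfl | hy | hy
    · exact Or.inr ((hB.adj_q s).2 (Or.inr hs))
    · exact Or.inl (hC hy hs)
    · exact Or.inr (((hB.adj_L y hy s).2 (hpar y hy).symm))
  have he : eternalDominationNumber T 2 ≤ eternalDominationNumber (T.induce A) 2 + 1 := by
    refine eternalDominationNumber_le_succ_of_pairwise_near (Embedding.induce A) Aᶜ ⟨q, hqA⟩
      (fun a ha b hb => ⟨s, hclose a ha, (hclose b hb).symm⟩) fun y => ?_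
    by_cases hy : y ∈ A
    · exact Or.inr ⟨⟨y, hy⟩, rfl⟩
    · exact Or.inl hy
  have hγ : dominationNumber (T.induce A) + 1 ≤ dominationNumber T := by
    obtain ⟨D, hD, hc⟩ := exists_isMinDominating T
    obtain ⟨d, hd, hd'⟩ := hB.exists_mem_of_isDominating_of_mem hD hℓ
    have hdq : d ≠ q := by
      rintro rfl
      rcases hd' with h | h
      · exact hB.q_notMem_C (h ▸ hB.par_mem ℓ hℓ)
      · exact hB.q_notMem_L h.1
    have hdA : d ∉ A := by
      rcases hd' with rfl | h
      · exact fun h => h (Or.inr (Or.inl (hB.par_mem ℓ hℓ)))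
      · exact hLA d h.1
    -- The member `d` near `ℓ` is not needed: only `q` can dominate `x` from outside, and `q ≠ d`
    -- survives to be replaced by `x`.
    obtain ⟨D₀, hD₀, hcard, -⟩ := exists_isDominating_induce (A := A) hB.x_mem
      (fun a ha b hb h => (hB.eq_x_of_adj ha hb h).2) (E := D.erase d) hD
      (fun w hw hwA => Finset.mem_erase.2 ⟨fun h => hdA (h ▸ hwA), hw⟩)
      (fun ⟨w, hw, hwA, hadj⟩ => by
        have := (hB.eq_x_of_adj hB.x_mem hwA hadj.symm).1
        exact ⟨q, Finset.mem_erase.2 ⟨hdq.symm, this ▸ hw⟩, Or.inr hqA⟩)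
    have := dominationNumber_le hD₀
    have := Finset.card_erase_add_one hd
    omega
  have hT₀ := ih A (fun h => hqA (h ▸ trivial)) hB.isTree_compl_insert (by omega)
  obtain ⟨k, f, hf, hL⟩ := exists_enumeration L
  have hk : 0 < k := by
    obtain ⟨i, -⟩ := (hL ℓ).1 hℓ
    exact i.pos
  have hfL : ∀ i, f i ∈ L := fun i => (hL _).2 ⟨i, rfl⟩
  have hLq : ∀ y ∈ L, ∀ z, z = q ∨ z ∈ L → ¬ T.Adj y z := by
    intro y hy z hz h
    have hzC : z ∈ C := (hB.adj_L y hy z).1 h ▸ hB.par_mem y hy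
    rcases hz with rfl | hz
    · exact hB.q_notMem_C hzC
    · exact hB.disjoint z hzC hz
  have hsnoc : ∀ i, (Fin.snoc f q : Fin (k + 1) → V) i = q ∨
      (Fin.snoc f q : Fin (k + 1) → V) i ∈ L :=
    Fin.lastCases (by simp) (by simp [hfL])
  -- Listing `q` last makes it `Fin.last (k + 1)`, the leaf through which `appendStar` attaches the
  -- star.
  obtain ⟨h, h0, hsucc⟩ := exists_star_embedding (T := T) s (Fin.snoc f q : Fin (k + 1) → V)
    (Fin.snoc_injective_iff.2 ⟨hf, fun ⟨i, hi⟩ => hB.q_notMem_L (hi ▸ hfL i)⟩)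
    (fun i => by
      rcases hsnoc i with h | h
      · rw [h]; exact ((hB.adj_q s).2 (Or.inr hs)).symm
      · exact (hB.adj_C s hs _).2 (Or.inr ⟨h, hpar _ h⟩))
    (fun i j hij => by
      rcases hsnoc i with h | h
      · rcases hsnoc j with h' | h'
        · rw [h, h'] at hij
          exact hij.ne rfl
        · exact hLq _ h' _ (Or.inl h) hij.symm
      · exact hLq _ h _ (hsnoc j) hij)
  have hlast : h (Fin.last (k + 1)) = q := by rw [← Fin.succ_last, hsucc]; simp
  have hrange : ∀ i, h i ∉ A := by
    refine Fin.cases (h0 ▸ hsA) fun i => ?_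
    rw [hsucc]
    rcases hsnoc i with h | h
    · rwa [h]
    · exact hLA _ h
  obtain ⟨φ, hφl, hφr⟩ := exists_attach_embedding (v := (⟨x, hB.x_mem⟩ : A))
    (B := {Fin.last (k + 1)}) (Embedding.induce (G := T) A) h
    (fun a w haw => hrange w (haw ▸ a.2)) (fun a w => by
      constructor
      · intro hadj
        obtain ⟨h₁, h₂⟩ := hB.eq_x_of_adj a.2 (hrange w) hadj
        exact ⟨Subtype.ext h₂, h.injective (h₁.trans hlast.symm)⟩
      · rintro ⟨rfl, rfl⟩
        rw [hlast]
        exact ((hB.adj_q x).2 (Or.inl rfl)).symm)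
  refine TreeFamily.iso _ _ (TreeFamily.appendStar _ hT₀ ⟨x, hB.x_mem⟩ (k + 1) (by omega))
    (RelIso.ofSurjective φ fun y => ?_)
  by_cases hy : y ∈ A
  · exact ⟨Sum.inl ⟨y, hy⟩, hφl _⟩
  rcases not_not.1 hy with rfl | hy | hy
  · exact ⟨Sum.inr (Fin.last _), (hφr _).trans hlast⟩
  · exact ⟨Sum.inr 0, (hφr _).trans (h0.trans (hC hs hy))⟩
  · obtain ⟨i, rfl⟩ := (hL y).1 hy
    exact ⟨Sum.inr i.castSucc.succ, by rw [hφr, hsucc, Fin.snoc_castSucc]⟩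

/-- The embedding of the tree above a branch together with the star at one child of `q`. -/
lemma exists_attach_star (hB : Branch T par q x C L) {s y : V} (hy : y ∈ L) (hs : par y = s) :
    ∃ (m : ℕ) (φ : attach (T.induce (C ∪ L)ᶜ) ⟨q, hB.q_mem⟩ (starK m) {0} ↪g T), 1 ≤ m ∧
      (∀ a, φ (Sum.inl a) = a) ∧ (∀ i, φ (Sum.inr i) = s ∨ φ (Sum.inr i) ∈ L ∧
        par (φ (Sum.inr i)) = s) ∧ φ (Sum.inr 0) = s ∧
      ∀ z, z ∈ L → par z = s → ∃ i, φ (Sum.inr i) = z := by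
  have hsC : s ∈ C := hs ▸ hB.par_mem y hy
  obtain ⟨m, h, h0, hL, hsurj⟩ := hB.exists_star hsC
  have hrange : ∀ i, h i ∉ (C ∪ L)ᶜ := by
    intro i hi
    by_cases hi0 : i = 0
    · exact hi (Or.inl (by rwa [hi0, h0]))
    · exact hi (Or.inr (hL i hi0).1)
  obtain ⟨φ, hφl, hφr⟩ := exists_attach_embedding (v := (⟨q, hB.q_mem⟩ : ((C ∪ L)ᶜ : Set V)))
    (B := {0}) (Embedding.induce (G := T) (C ∪ L)ᶜ) h
    (fun a w haw => hrange w (haw ▸ a.2)) (fun a w => by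
      constructor
      · intro hadj
        have haq := hB.eq_q_of_adj a.2 (hrange w) hadj
        refine ⟨Subtype.ext haq, by_contra fun hw => ?_⟩
        change T.Adj a (h w) at hadj
        rw [haq] at hadj
        rw [(hB.adj_L _ (hL w hw).1 q).1 hadj.symm] at haq
        exact hB.q_notMem_C ((hB.adj_L _ (hL w hw).1 q).1 hadj.symm ▸ hB.par_mem _ (hL w hw).1)
      · rintro ⟨rfl, rfl⟩
        rw [h0]
        exact (hB.adj_q s).2 (Or.inr hsC))
  refine ⟨m, φ, (hsurj y hy hs).1, hφl, fun i => ?_, (hφr 0).trans h0, fun z hz hzs => ?_⟩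
  · rw [hφr]
    by_cases hi0 : i = 0
    · exact Or.inl (by rw [hi0, h0])
    · exact Or.inr (hL i hi0)
  · obtain ⟨i, hi⟩ := (hsurj z hz hzs).2
    exact ⟨i, (hφr i).trans hi⟩

/-- If exactly one child of `q` has children, then the branch consists of a star appended at its
centre and of leaves. -/
lemma treeFamily_of_star_and_leaves (hB : Branch T par q x C L) {s c : V}
    (hs : ∀ y ∈ L, par y = s) (hc : c ∈ C) (hcs : c ≠ s)
    (heq : dominationNumber T ≤ eternalDominationNumber T 2)
    (ih : ∀ A : Set V, A ≠ Set.univ → (T.induce A).IsTree →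
      dominationNumber (T.induce A) ≤ eternalDominationNumber (T.induce A) 2 →
      TreeFamily (T.induce A)) : TreeFamily T := by
  classical
  obtain ⟨ℓ, hℓ⟩ := hB.nonempty
  have hsC : s ∈ C := hs ℓ hℓ ▸ hB.par_mem ℓ hℓ
  have he := hB.eternalDominationNumber_le
  have hle := eternalDominationNumber_le_dominationNumber (T.induce (C ∪ L)ᶜ)
  have hCA : ∀ y ∈ C, y ∉ (C ∪ L)ᶜ := fun y hy h => h (Or.inl hy)
  have hLA : ∀ y ∈ L, y ∉ (C ∪ L)ᶜ := fun y hy h => h (Or.inr hy)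
  have hadj_leaf : ∀ y ∈ C, y ≠ s → ∀ z, T.Adj y z → z = q := fun y hy hys z h =>
    ((hB.adj_C y hy z).1 h).resolve_right fun h => hys (h.2.symm.trans (hs z h.1))
  -- The childless `c` forces `c` or `q` into `D`. Dropping `d` and moving the members outside the
  -- smaller tree to `q` gives a dominating set through `q`; `he`, `hle` and `heq` then show that it
  -- is minimum.
  obtain ⟨D₀, hD₀, hqD₀, hcard⟩ : ∃ D₀, IsDominating (T.induce (C ∪ L)ᶜ) D₀ ∧
      ⟨q, hB.q_mem⟩ ∈ D₀ ∧ D₀.card + 1 ≤ dominationNumber T := by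
    obtain ⟨D, hD, hDc⟩ := exists_isMinDominating T
    obtain ⟨d, hd, hd'⟩ := hB.exists_mem_of_isDominating_of_mem hD hℓ
    rw [hs ℓ hℓ] at hd'
    have hdA : d ∉ (C ∪ L)ᶜ := hd'.elim (fun h => h ▸ hCA s hsC) fun h => hLA d h.1
    obtain ⟨w, hw, hwc⟩ := isDominating_iff.1 hD c
    have hwc' : w = c ∨ w = q := hwc.imp_right fun h => hadj_leaf c hc hcs w h.symm
    have hwd : w ≠ d := by
      rintro rfl
      rcases hd' with rfl | h
      · rcases hwc' with rfl | rfl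
        · exact hcs rfl
        · exact hB.q_notMem_C hsC
      · rcases hwc' with rfl | rfl
        · exact hB.disjoint _ hc h.1
        · exact hB.q_notMem_L h.1
    have hex : ∃ w ∈ D.erase d, w = q ∨ w ∉ (C ∪ L)ᶜ :=
      ⟨w, Finset.mem_erase.2 ⟨hwd, hw⟩, hwc'.elim (fun h => Or.inr (h ▸ hCA c hc)) Or.inl⟩
    obtain ⟨D₀, hD₀, hcard, hmem⟩ := exists_isDominating_induce (A := (C ∪ L)ᶜ) hB.q_mem
      (fun a ha b hb h => hB.eq_q_of_adj ha hb h) (E := D.erase d) hD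
      (fun w hw hwA => Finset.mem_erase.2 ⟨fun h => hdA (h ▸ hwA), hw⟩) (fun _ => hex)
    have := Finset.card_erase_add_one hd
    exact ⟨D₀, hD₀, hmem hex, by omega⟩
  have hγ := dominationNumber_le hD₀
  have hT₀ := ih (C ∪ L)ᶜ (fun h => hCA s hsC (h ▸ trivial)) hB.isTree_compl (by omega)
  obtain ⟨m, φ, hm, hφl, hφr, hφ0, hφL⟩ := hB.exists_attach_star hℓ (hs ℓ hℓ)
  obtain ⟨t, f, hf, hfC⟩ := exists_enumeration (C \ {s})
  have hfmem : ∀ i, f i ∈ C ∧ f i ≠ s := fun i => (hfC _).2 ⟨i, rfl⟩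
  let h : (⊥ : SimpleGraph (Fin t)) ↪g T := ⟨⟨f, hf⟩, fun {i j} => by
    simp only [Function.Embedding.coeFn_mk, bot_adj, iff_false]
    intro hij
    have := hadj_leaf _ (hfmem i).1 (hfmem i).2 _ hij
    exact hB.q_notMem_C (this ▸ (hfmem j).1)⟩
  have hφC : ∀ a i, φ a ≠ f i := by
    rintro (a | j) i hai
    · rw [hφl] at hai
      exact hCA _ (hfmem i).1 (hai ▸ a.2)
    · rcases hφr j with hj | hj
      · exact (hfmem i).2 (hai.symm.trans hj)
      · exact hB.disjoint _ (hfmem i).1 (hai ▸ hj.1)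
  obtain ⟨ψ, hψl, hψr⟩ := exists_attach_embedding
    (v := (Sum.inl ⟨q, hB.q_mem⟩ : ((C ∪ L)ᶜ : Set V) ⊕ Fin (m + 1))) (B := Set.univ) φ h hφC
    (fun a i => by
      constructor
      · intro hadj
        refine ⟨φ.injective ?_, trivial⟩
        rw [hφl]
        exact hadj_leaf _ (hfmem i).1 (hfmem i).2 _ hadj.symm
      · rintro ⟨rfl, -⟩
        rw [hφl]
        exact (hB.adj_q _).2 (Or.inr (hfmem i).1))
  obtain ⟨i₀, -⟩ := (hfC c).1 ⟨hc, hcs⟩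
  refine TreeFamily.iso _ _ (TreeFamily.appendStarLeaves _ hT₀ ⟨q, hB.q_mem⟩ hB.isLeaf_q
    ⟨D₀, ⟨hD₀, by omega⟩, hqD₀⟩ m t hm i₀.pos) (RelIso.ofSurjective ψ fun y => ?_)
  by_cases hy : y ∈ (C ∪ L)ᶜ
  · exact ⟨Sum.inl (Sum.inl ⟨y, hy⟩), (hψl _).trans (hφl _)⟩
  rcases not_not.1 hy with hy | hy
  · by_cases hys : y = s
    · exact ⟨Sum.inl (Sum.inr 0), (hψl _).trans (hφ0.trans hys.symm)⟩
    · obtain ⟨i, rfl⟩ := (hfC y).1 ⟨hy, hys⟩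
      exact ⟨Sum.inr i, hψr i⟩
  · obtain ⟨i, hi⟩ := hφL y hy (hs y hy)
    exact ⟨Sum.inl (Sum.inr i), (hψl _).trans hi⟩

/-- If at least two children of `q` have children, then the branch consists of two stars, each
appended at its centre. -/
lemma treeFamily_of_two_stars (hB : Branch T par q x C L) {y z : V} (hy : y ∈ L) (hz : z ∈ L)
    (hyz : par y ≠ par z) (heq : dominationNumber T ≤ eternalDominationNumber T 2)
    (ih : ∀ A : Set V, A ≠ Set.univ → (T.induce A).IsTree →
      dominationNumber (T.induce A) ≤ eternalDominationNumber (T.induce A) 2 →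
      TreeFamily (T.induce A)) : TreeFamily T := by
  classical
  have hyC := hB.par_mem y hy
  have hzC := hB.par_mem z hz
  have he := hB.eternalDominationNumber_le
  have hle := eternalDominationNumber_le_dominationNumber (T.induce (C ∪ L)ᶜ)
  have hCA : ∀ y ∈ C, y ∉ (C ∪ L)ᶜ := fun y hy h => h (Or.inl hy)
  have hLA : ∀ y ∈ L, y ∉ (C ∪ L)ᶜ := fun y hy h => h (Or.inr hy)
  obtain ⟨D, hD, hDc⟩ := exists_isMinDominating T
  obtain ⟨d, hd, hd'⟩ := hB.exists_mem_of_isDominating_of_mem hD hy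
  obtain ⟨e, heD, he'⟩ := hB.exists_mem_of_isDominating_of_mem hD hz
  have hblock : ∀ {c d}, c ∈ C → (d = c ∨ d ∈ L ∧ par d = c) → d ∉ (C ∪ L)ᶜ := fun hc h =>
    h.elim (fun h => h ▸ hCA _ hc) fun h => hLA _ h.1
  have hdisj : ∀ {c c' d}, c ∈ C → c' ∈ C → c ≠ c' → (d = c ∨ d ∈ L ∧ par d = c) →
      ¬ (d = c' ∨ d ∈ L ∧ par d = c') := by
    rintro c c' d hc hc' hne (rfl | h) (rfl | h')
    · exact hne rfl
    · exact hB.disjoint _ hc h'.1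
    · exact hB.disjoint _ hc' h.1
    · exact hne (h.2.symm.trans h'.2)
  have hde : e ≠ d := fun h => hdisj hyC hzC hyz hd' (h ▸ he')
  let E := (D.erase d).erase e
  have hEcard : E.card + 2 = D.card := by
    have h₁ := Finset.card_erase_add_one hd
    have h₂ : E.card + 1 = _ := Finset.card_erase_add_one (Finset.mem_erase.2 ⟨hde, heD⟩)
    omega
  have hDE : ∀ w ∈ D, w ∈ (C ∪ L)ᶜ → w ∈ E := fun w hw hwA =>
    Finset.mem_erase.2 ⟨fun h => hblock hzC he' (h ▸ hwA),
      Finset.mem_erase.2 ⟨fun h => hblock hyC hd' (h ▸ hwA), hw⟩⟩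
  have hedge : ∀ a ∈ (C ∪ L)ᶜ, ∀ b ∉ (C ∪ L)ᶜ, T.Adj a b → a = q :=
    fun a ha b hb h => hB.eq_q_of_adj ha hb h
  -- Otherwise `E`, with its outside members moved to `q`, would dominate the smaller tree with
  -- `γ(T) - 2` vertices, whereas its domination number is at least `γ(T) - 1`.
  have hnone : ¬ ∃ w ∈ E, w = q ∨ w ∉ (C ∪ L)ᶜ := by
    intro hex
    obtain ⟨D₀, hD₀, hcard, -⟩ := exists_isDominating_induce hB.q_mem hedge hD hDE fun _ => hex
    have := dominationNumber_le hD₀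
    omega
  have hqD : q ∉ D := fun h => hnone ⟨q, hDE q h hB.q_mem, Or.inl rfl⟩
  -- As `q ∉ D`, a third child would need yet another member of `D` outside the smaller tree.
  have hCyz : ∀ c ∈ C, c = par y ∨ c = par z := by
    intro c hc
    by_contra! hcon
    obtain ⟨w, hw, hw'⟩ := hB.exists_mem_of_isDominating hD hc
    have hwq : w ≠ q := fun h => hqD (h ▸ hw)
    have hw'' : w = c ∨ w ∈ L ∧ par w = c := hw'.imp_right fun h => h.resolve_left hwq
    refine hnone ⟨w, Finset.mem_erase.2 ⟨?_, Finset.mem_erase.2 ⟨?_, hw⟩⟩,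
      Or.inr (hblock hc hw'')⟩
    · rintro rfl
      exact hdisj hc hzC hcon.2 hw'' he'
    · rintro rfl
      exact hdisj hc hyC hcon.1 hw'' hd'
  -- Deleting `q` from the smaller tree leaves domination number at most `γ(T) - 2`. With `γ(T) - 1`
  -- as lower bound before the deletion, the condition of operation 4 follows.
  have hγ₁ := dominationNumber_induce_induce_le hB.q_mem hedge hD hDE hqD
  have hγ₂ := dominationNumber_le_induce_compl_singleton (T.induce (C ∪ L)ᶜ) ⟨q, hB.q_mem⟩
  have hT₀ := ih (C ∪ L)ᶜ (fun h => hCA _ hyC (h ▸ trivial)) hB.isTree_compl (by omega)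
  obtain ⟨m, φ, hm, hφl, hφr, hφ0, hφL⟩ := hB.exists_attach_star hy rfl
  obtain ⟨M, h, h0, hL, hsurj⟩ := hB.exists_star hzC
  have hh : ∀ i, h i = par z ∨ h i ∈ L ∧ par (h i) = par z := fun i =>
    if hi : i = 0 then Or.inl (hi ▸ h0) else Or.inr (hL i hi)
  have hφh : ∀ a i, φ a ≠ h i := by
    rintro (a | j) i hai
    · rw [hφl] at hai
      exact hblock hzC (hh i) (hai ▸ a.2)
    · exact hdisj hyC hzC hyz (hφr j) (hai ▸ hh i)
  obtain ⟨ψ, hψl, hψr⟩ := exists_attach_embedding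
    (v := (Sum.inl ⟨q, hB.q_mem⟩ : ((C ∪ L)ᶜ : Set V) ⊕ Fin (m + 1))) (B := {0}) φ h hφh
    (fun a i => by
      constructor
      · intro hadj
        by_cases hi : i = 0
        · refine ⟨φ.injective ?_, hi⟩
          rw [hφl]
          rw [hi, h0] at hadj
          rcases (hB.adj_C _ hzC _).1 hadj.symm with h | h
          · exact h
          · rcases a with a | j
            · exact absurd (hφl a ▸ a.2) (hLA _ h.1)
            · exact absurd (Or.inr h) (hdisj hyC hzC hyz (hφr j))
        · have := (hB.adj_L _ (hL i hi).1 _).1 hadj.symm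
          rw [(hL i hi).2, ← h0] at this
          exact absurd this (hφh a 0)
      · rintro ⟨rfl, rfl⟩
        rw [hφl, h0]
        exact (hB.adj_q _).2 (Or.inr hzC))
  refine TreeFamily.iso _ _ (TreeFamily.appendTwoStars _ hT₀ ⟨q, hB.q_mem⟩ hB.isLeaf_q
    (by omega) m M hm (hsurj z hz rfl).1) (RelIso.ofSurjective ψ fun w => ?_)
  have hcover : ∀ w, (w = par z ∨ w ∈ L ∧ par w = par z) → ∃ a, ψ a = w := by
    rintro w (rfl | hw)
    · exact ⟨Sum.inr 0, (hψr 0).trans h0⟩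
    · obtain ⟨i, hi⟩ := (hsurj w hw.1 hw.2).2
      exact ⟨Sum.inr i, (hψr i).trans hi⟩
  by_cases hw : w ∈ (C ∪ L)ᶜ
  · exact ⟨Sum.inl (Sum.inl ⟨w, hw⟩), (hψl _).trans (hφl _)⟩
  rcases not_not.1 hw with hw | hw
  · rcases hCyz w hw with rfl | h
    · exact ⟨Sum.inl (Sum.inr 0), (hψl _).trans hφ0⟩
    · exact hcover w (Or.inl h)
  · rcases hCyz _ (hB.par_mem w hw) with h | h
    · obtain ⟨i, hi⟩ := hφL w hw h
      exact ⟨Sum.inl (Sum.inr i), (hψl _).trans hi⟩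
    · exact hcover w (Or.inr ⟨hw, h⟩)

end Branch

/-- A tree that needs as many guards as its domination number belongs to the family. -/
theorem treeFamily_of_dominationNumber_le {V : Type u} [Finite V] {T : SimpleGraph V}
    (hT : T.IsTree) (heq : dominationNumber T ≤ eternalDominationNumber T 2) : TreeFamily T := by
  induction hn : Nat.card V using Nat.strong_induction_on generalizing V with
  | _ n IH =>
  subst hn
  by_cases hd : T.diam ≤ 3
  · exact TreeFamily.small T hT hd
  have ih : ∀ A : Set V, A ≠ Set.univ → (T.induce A).IsTree →
      dominationNumber (T.induce A) ≤ eternalDominationNumber (T.induce A) 2 →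
      TreeFamily (T.induce A) := fun A hA hTA h =>
    IH _ (by
      rw [Nat.card_coe_set_eq, ← Set.ncard_univ]
      exact Set.ncard_lt_ncard ((Set.ssubset_univ_iff).2 hA)) hTA h rfl
  obtain ⟨par, q, x, C, L, hB⟩ := exists_branch hT (not_le.1 hd)
  by_cases hC : C.Subsingleton
  · exact hB.treeFamily_of_subsingleton hC heq ih
  by_cases hL : ∃ y ∈ L, ∃ z ∈ L, par y ≠ par z
  · obtain ⟨y, hy, z, hz, hyz⟩ := hL
    exact hB.treeFamily_of_two_stars hy hz hyz heq ih
  push Not at hL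
  obtain ⟨ℓ, hℓ⟩ := hB.nonempty
  obtain ⟨c, hc, hcs⟩ := (Set.not_subsingleton_iff.1 hC).exists_ne (par ℓ)
  exact hB.treeFamily_of_star_and_leaves (fun y hy => hL y hy ℓ hℓ) hc hcs heq ih

end EternalDomination

theorem mainTheorem1 {V : Type*} [Finite V] (T : SimpleGraph V) (hT : T.IsTree) :
    EternalDomination.eternalDominationNumber T 2 = EternalDomination.dominationNumber T ↔
      EternalDomination.TreeFamily T :=
  ⟨fun h => EternalDomination.treeFamily_of_dominationNumber_le hT h.ge,
    fun h => le_antisymm (EternalDomination.eternalDominationNumber_le_dominationNumber T)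
      h.finite_and_dominationNumber_le.2⟩
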